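/- Let $g,t$ be positive integers and let $K$ be a set of positive integers. A $(gt,g,K,1)$ cyclic difference family is a family $\mathcal F$ of subsets of $\mathbb Z_{gt}$ (the base blocks) such that (1) $|B|\in K$ for every $B\in\mathcal F$; and (2) the multiset union $\Delta\mathcal F=\bigcup_{B\in\mathcal F}\Delta B$ of the difference lists $\Delta B=\{x-y : x,y\in B,\ x\neq y\}$ contains each element of $\mathbb Z_{gt}\setminus\{0,t,2t,\ldots,(g-1)t\}$ exactly once and contains no element of $\{0,t,2t,\ldots,(g-1)t\}$. **Lemma.** For every even integer $t\ge 4$ there exists a $(16t,16,\{3,5\},1)$ cyclic difference family. -/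

import Mathlib

/-- The list of differences `ΔB = {x - y : x, y ∈ B, x ≠ y}` of a block `B`, with multiplicities. -/
def CDF.differences {G : Type*} [AddCommGroup G] [DecidableEq G] (B : Finset G) : Multiset G :=
  B.offDiag.val.map fun p => p.1 - p.2

/-- `IsCyclicDifferenceFamily g t K F`: the family `F` of subsets (base blocks) of `ℤ/gtℤ` is a
`(gt, g, K, 1)`-cyclic difference family. Every base block has its size in `K`, and the list of all
differences of the base blocks consists of each element of `ℤ/gtℤ` outside the subgroup
`{0, t, 2t, …, (g-1)t}` exactly once, and of no element of that subgroup. -/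
structure IsCyclicDifferenceFamily (g t : ℕ) (K : Set ℕ) (F : Finset (Finset (ZMod (g * t)))) :
    Prop where
  card_mem : ∀ B ∈ F, B.card ∈ K
  count_eq_one : ∀ d : ZMod (g * t), (¬ ∃ i < g, d = ((i * t : ℕ) : ZMod (g * t))) →
    (∑ B ∈ F, CDF.differences B).count d = 1
  count_eq_zero : ∀ d : ZMod (g * t), (∃ i < g, d = ((i * t : ℕ) : ZMod (g * t))) →
    (∑ B ∈ F, CDF.differences B).count d = 0

/-!
Work with base blocks of natural numbers, to be reduced modulo `16t`. If a list of blocks has at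
most `16t - 16` ordered differences altogether and realizes every element outside the subgroup
generated by `t`, then by counting it realizes each of them exactly once, and the blocks neither
coincide nor lose elements modulo `16t`. So disjointness of the differences never has to be checked,
and by the symmetry `d ↦ -d` only the differences up to `8t` have to be found.

These come from two runs of triples: `{0, 2i, c₀ + i}`, with differences `2i` and `c₀ ± i`, and
`{0, 2i + 1, c₁ + i + 1}`, with differences `2i + 1`, `c₁ - i` and `c₁ + i + 1`. For `c₀ = 4t` and
`c₁` near `20t/3` the run lengths can be chosen so that the even and odd differences fill an initial
segment of `[1, 8t]`, while the rest is filled, except for short gaps, by the intervals around `c₀`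
and `c₁`. Some indices are skipped, to avoid multiples of `t` such as `2 * (t / 2)` and `c₀ ± t`,
and to free the differences that a bounded number of extra blocks needs to fill the gaps.
-/

theorem IsCyclicDifferenceFamily.mono {g t : ℕ} {K K' : Set ℕ}
    {F : Finset (Finset (ZMod (g * t)))} (h : IsCyclicDifferenceFamily g t K F) (hK : K ⊆ K') :
    IsCyclicDifferenceFamily g t K' F where
  card_mem B hB := hK (h.card_mem B hB)
  count_eq_one := h.count_eq_one
  count_eq_zero := h.count_eq_zero

namespace CDF

section Differences

variable {G : Type*} [AddCommGroup G] [DecidableEq G]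

lemma mem_differences {B : Finset G} {d : G} :
    d ∈ differences B ↔ ∃ x ∈ B, ∃ y ∈ B, x ≠ y ∧ x - y = d := by
  simp [differences, Finset.mem_offDiag, and_assoc]

lemma card_differences (B : Finset G) : (differences B).card = B.card * (B.card - 1) := by
  rw [differences, Multiset.card_map, Finset.card_val, Finset.offDiag_card, Nat.mul_sub_one]

lemma card_differences_toFinset_le (l : List G) :
    (differences l.toFinset).card ≤ l.length * (l.length - 1) := by
  rw [card_differences]
  have := List.toFinset_card_le l
  gcongr

lemma card_differences_toFinset_lt {l : List G} (h : l.toFinset.card < l.length) :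
    (differences l.toFinset).card < l.length * (l.length - 1) := by
  have hpos : 0 < l.toFinset.card :=
    Finset.card_pos.2 (List.toFinset_nonempty_iff l |>.2 (List.ne_nil_of_length_pos (by omega)))
  rw [card_differences]
  exact Nat.mul_lt_mul_of_lt_of_le h (by omega) (by omega)

lemma sum_differences_toFinset_le (L : List (Finset G)) :
    ∑ B ∈ L.toFinset, differences B ≤ (L.map differences).sum := by
  rw [Finset.sum, List.toFinset_val, Multiset.map_coe, Multiset.sum_coe]
  exact ((List.dedup_sublist L).map differences).sum_le_sum fun _ _ => Multiset.zero_le _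

lemma card_sum_map_differences (L : List (Finset G)) :
    (L.map differences).sum.card = (L.map fun B => (differences B).card).sum := by
  simpa [Function.comp_def] using map_list_sum Multiset.cardHom (L.map differences)

theorem sum_differences_eq_and_card_eq_of_card_le {L : List (List G)} {S : Finset G} (h0 : 0 ∉ S)
    (hcard : (L.map fun l => l.length * (l.length - 1)).sum ≤ S.card)
    (hcov : ∀ d ∈ S, ∃ l ∈ L, ∃ x ∈ l, ∃ y ∈ l, x - y = d) :
    ∑ B ∈ (L.map List.toFinset).toFinset, differences B = S.val ∧
      ∀ l ∈ L, l.toFinset.card = l.length := by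
  set F := (L.map List.toFinset).toFinset with hF
  set M := ((L.map List.toFinset).map differences).sum
  have hSF : S.val ≤ ∑ B ∈ F, differences B := by
    rw [Multiset.le_iff_subset S.nodup]
    intro d hd
    obtain ⟨l, hl, x, hx, y, hy, rfl⟩ := hcov d hd
    have hxy : x ≠ y := fun h => h0 (by simpa [h] using hd)
    refine Multiset.mem_sum.2 ⟨l.toFinset, by simpa [hF] using ⟨l, hl, rfl⟩, ?_⟩
    exact mem_differences.2 ⟨x, by simpa, y, by simpa, hxy, rfl⟩
  have hFM : ∑ B ∈ F, differences B ≤ M := sum_differences_toFinset_le _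
  have hM : M.card = (L.map fun l => (differences l.toFinset).card).sum := by
    rw [card_sum_map_differences, List.map_map]
    rfl
  have hMS : M.card ≤ S.card :=
    (hM.trans_le (List.sum_le_sum fun l _ => card_differences_toFinset_le l)).trans hcard
  refine ⟨(Multiset.eq_of_le_of_card_le hSF ((Multiset.card_le_card hFM).trans hMS)).symm, ?_⟩
  intro l hl
  by_contra hne
  have hlt : l.toFinset.card < l.length := (List.toFinset_card_le l).lt_of_ne hne
  have hMlt : M.card < S.card := by
    refine lt_of_lt_of_le ?_ hcard
    rw [hM]
    exact List.sum_lt_sum _ _ (fun l _ => card_differences_toFinset_le l)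
      ⟨l, hl, card_differences_toFinset_lt hlt⟩
  exact hMlt.not_ge (Multiset.card_le_card (hSF.trans hFM))

end Differences

/-- The subgroup `{0, t, 2t, …, (g-1)t}` of `ℤ/gtℤ` whose elements a cyclic difference family
avoids, as a finite set. -/
def multiples (g t : ℕ) : Finset (ZMod (g * t)) :=
  (Finset.range g).image fun i => ((i * t : ℕ) : ZMod (g * t))

lemma mem_multiples {g t : ℕ} {d : ZMod (g * t)} :
    d ∈ multiples g t ↔ ∃ i < g, d = ((i * t : ℕ) : ZMod (g * t)) := by
  simp only [multiples, Finset.mem_image, Finset.mem_range, eq_comm]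

lemma mem_multiples_of_dvd_val {g t : ℕ} [NeZero (g * t)] {d : ZMod (g * t)} (h : t ∣ d.val) :
    d ∈ multiples g t := by
  obtain ⟨i, hi⟩ := h
  have hlt : t * i < t * g := by simpa only [hi, mul_comm g t] using ZMod.val_lt d
  refine mem_multiples.2 ⟨i, lt_of_mul_lt_mul_left' hlt, ?_⟩
  rw [mul_comm i t, ← hi, ZMod.natCast_zmod_val]

lemma le_card_compl_multiples (g t : ℕ) [NeZero (g * t)] :
    g * t - g ≤ (multiples g t)ᶜ.card := by
  have : (multiples g t).card ≤ g := Finset.card_image_le.trans_eq (Finset.card_range g)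
  rw [Finset.card_compl, ZMod.card]
  omega

lemma isCyclicDifferenceFamily_of_sum_differences_eq {g t : ℕ} [NeZero (g * t)] {K : Set ℕ}
    {F : Finset (Finset (ZMod (g * t)))} (hK : ∀ B ∈ F, B.card ∈ K)
    (h : ∑ B ∈ F, differences B = (multiples g t)ᶜ.val) : IsCyclicDifferenceFamily g t K F where
  card_mem := hK
  count_eq_one d hd := by
    rw [h]
    exact Multiset.count_eq_one_of_mem (Finset.nodup _)
      (Finset.mem_compl.2 (mt mem_multiples.1 hd))
  count_eq_zero d hd := by
    rw [h, Multiset.count_eq_zero, Finset.mem_val, Finset.mem_compl, not_not]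
    exact mem_multiples.2 hd

/-- The base blocks in `L`, lists of natural numbers still to be reduced modulo the order of the
group, realize the difference `x`. -/
def Covers (L : List (List ℕ)) (x : ℕ) : Prop :=
  ∃ l ∈ L, ∃ p ∈ l, ∃ q ∈ l, p = q + x

instance (L : List (List ℕ)) : DecidablePred (Covers L) := fun x =>
  inferInstanceAs (Decidable (∃ l ∈ L, ∃ p ∈ l, ∃ q ∈ l, p = q + x))

lemma Covers.mono {L L' : List (List ℕ)} {x : ℕ} (h : L ⊆ L') : Covers L x → Covers L' x :=
  fun ⟨l, hl, hx⟩ => ⟨l, h hl, hx⟩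

lemma Covers.exists_sub_eq {L : List (List ℕ)} {n : ℕ} [NeZero n] {d : ZMod n}
    (h : Covers L d.val ∨ Covers L (n - d.val)) :
    ∃ l ∈ L, ∃ p ∈ l, ∃ q ∈ l, (p : ZMod n) - q = d := by
  have hd : ((d.val : ℕ) : ZMod n) = d := ZMod.natCast_zmod_val d
  obtain ⟨l, hl, p, hp, q, hq, rfl⟩ | ⟨l, hl, p, hp, q, hq, rfl⟩ := h
  · exact ⟨l, hl, _, hp, q, hq, by rw [Nat.cast_add, hd, add_sub_cancel_left]⟩
  · refine ⟨l, hl, q, hq, _, hp, ?_⟩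
    rw [Nat.cast_add, Nat.cast_sub (ZMod.val_lt d).le, hd, ZMod.natCast_self]
    ring

theorem exists_isCyclicDifferenceFamily_of_covers {g t : ℕ} {K : Set ℕ} (hg : 0 < g) (ht : 0 < t)
    (L : List (List ℕ)) (hK : ∀ l ∈ L, l.length ∈ K)
    (hcard : (L.map fun l => l.length * (l.length - 1)).sum = g * t - g)
    (hcov : ∀ x ≤ g * t / 2, ¬ t ∣ x → Covers L x) :
    ∃ F : Finset (Finset (ZMod (g * t))), IsCyclicDifferenceFamily g t K F := by
  have : NeZero (g * t) := ⟨(Nat.mul_pos hg ht).ne'⟩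
  have h0 : 0 ∉ (multiples g t)ᶜ := by
    simpa using mem_multiples_of_dvd_val (d := (0 : ZMod (g * t))) (by simp)
  have hcovZ : ∀ d ∈ (multiples g t)ᶜ, ∃ l ∈ L.map (List.map (Nat.cast : ℕ → ZMod (g * t))),
      ∃ x ∈ l, ∃ y ∈ l, x - y = d := by
    intro d hd
    have hdvd : ¬ t ∣ d.val := mt mem_multiples_of_dvd_val (Finset.mem_compl.1 hd)
    have hdvd' : ¬ t ∣ g * t - d.val := by
      rwa [Nat.dvd_sub_iff_right (ZMod.val_lt d).le (dvd_mul_left t g)]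
    have hhalf : Covers L d.val ∨ Covers L (g * t - d.val) := by
      obtain h | h := le_or_gt (2 * d.val) (g * t)
      · exact .inl (hcov _ (by omega) hdvd)
      · exact .inr (hcov _ (by omega) hdvd')
    obtain ⟨l, hl, p, hp, q, hq, hpq⟩ := Covers.exists_sub_eq hhalf
    exact ⟨_, List.mem_map_of_mem hl, p, List.mem_map_of_mem hp, q, List.mem_map_of_mem hq, hpq⟩
  obtain ⟨hsum, hlen⟩ := sum_differences_eq_and_card_eq_of_card_le h0
    (by simpa [Function.comp_def, hcard] using le_card_compl_multiples g t) hcovZ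
  refine ⟨_, isCyclicDifferenceFamily_of_sum_differences_eq ?_ hsum⟩
  simp only [List.mem_toFinset, List.forall_mem_map, List.length_map] at hlen ⊢
  exact fun l hl => hlen l hl ▸ hK l hl

/-- `x` is a difference of the triple `{0, 2i + e, c + i + e}`, where `i ≤ c`; the difference
`c - i` is written without subtraction. -/
def IsTripleDifference (e c i x : ℕ) : Prop :=
  x = 2 * i + e ∨ x = c + i + e ∨ x + i = c

/-- The run of triples `{0, 2i + e, c + i + e}` with `i < n`, without those with `i ∈ E`. It is used
with `e = 0` for even and `e = 1` for odd differences. -/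
noncomputable def triples (e c n : ℕ) (E : Finset ℕ) : List (List ℕ) :=
  (Finset.range n \ E).toList.map fun i => [0, 2 * i + e, c + i + e]

/-- `x` is a difference of a triple omitted from `triples e c n E` because its index lies in `E`. -/
def IsSkipped (e c : ℕ) (E : Finset ℕ) (x : ℕ) : Prop :=
  ∃ i ∈ E, IsTripleDifference e c i x

/-- `x` is not reached by the runs of `n₀` even triples around `c₀` and `n₁` odd ones around `c₁`:
it lies between their initial run of numbers and the interval `(c₀ - n₀, c₀ + n₀)`, between that
interval and `(c₁ - n₁, c₁ + n₁]`, or beyond the latter. -/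
def InGap (c₀ n₀ c₁ n₁ x : ℕ) : Prop :=
  min (2 * n₀) (2 * n₁ + 1) ≤ x ∧ x + n₀ ≤ c₀ ∨ c₀ + n₀ ≤ x ∧ x + n₁ ≤ c₁ ∨ c₁ + n₁ < x

lemma length_of_mem_triples {e c n : ℕ} {E : Finset ℕ} {l : List ℕ} (hl : l ∈ triples e c n E) :
    l.length = 3 := by
  obtain ⟨i, -, rfl⟩ := List.mem_map.1 hl
  rfl

lemma sum_length_triples {n : ℕ} {E : Finset ℕ} (e c : ℕ) (hE : E ⊆ Finset.range n) :
    ((triples e c n E).map fun l => l.length * (l.length - 1)).sum = (n - E.card) * 6 := by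
  simp [triples, Function.comp_def, Finset.card_sdiff_of_subset hE]

lemma covers_triples {e c n i x : ℕ} {E : Finset ℕ} (hin : i < n) (hiE : i ∉ E)
    (hx : IsTripleDifference e c i x) : Covers (triples e c n E) x := by
  refine ⟨_, List.mem_map_of_mem (a := i) (by simp [hin, hiE]), ?_⟩
  simp only [List.mem_cons, List.not_mem_nil, or_false, exists_eq_or_imp, exists_eq_left]
  unfold IsTripleDifference at hx
  omega

lemma covers_triples_or_isSkipped {e c n i x : ℕ} (E : Finset ℕ) (hin : i < n)
    (hx : IsTripleDifference e c i x) : Covers (triples e c n E) x ∨ IsSkipped e c E x := by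
  by_cases hiE : i ∈ E
  · exact .inr ⟨i, hiE, hx⟩
  · exact .inl (covers_triples hin hiE hx)

lemma exists_isTripleDifference_of_not_inGap {c₀ n₀ c₁ n₁ x : ℕ} (h : ¬ InGap c₀ n₀ c₁ n₁ x) :
    (∃ i < n₀, IsTripleDifference 0 c₀ i x) ∨ ∃ i < n₁, IsTripleDifference 1 c₁ i x := by
  have hregion : (x % 2 = 0 ∧ x < 2 * n₀) ∨ (x % 2 = 1 ∧ x < 2 * n₁ + 1) ∨
      (c₀ < x + n₀ ∧ x ≤ c₀) ∨ (c₀ ≤ x ∧ x < c₀ + n₀) ∨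
      (c₁ < x + n₁ ∧ x ≤ c₁) ∨ (c₁ < x ∧ x ≤ c₁ + n₁) := by
    unfold InGap at h
    omega
  unfold IsTripleDifference
  obtain h | h | h | h | h | h := hregion
  · exact .inl ⟨x / 2, by omega⟩
  · exact .inr ⟨x / 2, by omega⟩
  · exact .inl ⟨c₀ - x, by omega⟩
  · exact .inl ⟨x - c₀, by omega⟩
  · exact .inr ⟨c₁ - x, by omega⟩
  · exact .inr ⟨x - c₁ - 1, by omega⟩

lemma covers_triples_or_isSkipped_or_inGap (c₀ n₀ c₁ n₁ : ℕ) (E₀ E₁ : Finset ℕ) (x : ℕ) :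
    Covers (triples 0 c₀ n₀ E₀ ++ triples 1 c₁ n₁ E₁) x ∨
      IsSkipped 0 c₀ E₀ x ∨ IsSkipped 1 c₁ E₁ x ∨ InGap c₀ n₀ c₁ n₁ x := by
  by_cases hgap : InGap c₀ n₀ c₁ n₁ x
  · exact .inr (.inr (.inr hgap))
  obtain ⟨i, hi, hx⟩ | ⟨i, hi, hx⟩ := exists_isTripleDifference_of_not_inGap hgap
  · obtain h | h := covers_triples_or_isSkipped E₀ hi hx
    · exact .inl (h.mono (List.subset_append_left _ _))
    · exact .inr (.inl h)
  · obtain h | h := covers_triples_or_isSkipped E₁ hi hx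
    · exact .inl (h.mono (List.subset_append_right _ _))
    · exact .inr (.inr (.inl h))

theorem exists_isCyclicDifferenceFamily_of_triples {g t : ℕ} {K : Set ℕ} (hg : 0 < g) (ht : 0 < t)
    {c₀ n₀ c₁ n₁ : ℕ} {E₀ E₁ : Finset ℕ} (hE₀ : E₀ ⊆ Finset.range n₀) (hE₁ : E₁ ⊆ Finset.range n₁)
    (R : List (List ℕ)) (h3 : 3 ∈ K) (hR : ∀ l ∈ R, l.length ∈ K)
    (hcard : (n₀ - E₀.card) * 6 + (n₁ - E₁.card) * 6 +
      (R.map fun l => l.length * (l.length - 1)).sum = g * t - g)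
    (hcov : ∀ x ≤ g * t / 2, ¬ t ∣ x →
      IsSkipped 0 c₀ E₀ x ∨ IsSkipped 1 c₁ E₁ x ∨ InGap c₀ n₀ c₁ n₁ x → Covers R x) :
    ∃ F : Finset (Finset (ZMod (g * t))), IsCyclicDifferenceFamily g t K F := by
  refine exists_isCyclicDifferenceFamily_of_covers hg ht
    (triples 0 c₀ n₀ E₀ ++ triples 1 c₁ n₁ E₁ ++ R) ?_ ?_ ?_
  · simp only [List.mem_append]
    rintro l ((hl | hl) | hl)
    · rwa [length_of_mem_triples hl]
    · rwa [length_of_mem_triples hl]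
    · exact hR l hl
  · rw [List.map_append, List.map_append, List.sum_append, List.sum_append,
      sum_length_triples 0 c₀ hE₀, sum_length_triples 1 c₁ hE₁, hcard]
  · intro x hx htx
    obtain h | h := covers_triples_or_isSkipped_or_inGap c₀ n₀ c₁ n₁ E₀ E₁ x
    · exact h.mono (List.subset_append_left _ _)
    · exact (hcov x hx htx h).mono (List.subset_append_right _ _)

lemma exists_isCyclicDifferenceFamily_six_mul_add_ten (k : ℕ) :
    ∃ F : Finset (Finset (ZMod (16 * (6 * k + 10)))),
      IsCyclicDifferenceFamily 16 (6 * k + 10) {3} F := by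
  refine exists_isCyclicDifferenceFamily_of_triples (by norm_num) (by omega)
    (c₀ := 24 * k + 40) (n₀ := 8 * k + 11) (E₀ := {0, 3 * k + 5, 6 * k + 10})
    (c₁ := 40 * k + 66) (n₁ := 8 * k + 11)
    (E₁ := {0, 1, 2, 2 * k + 3, 3 * k + 4, 4 * k + 5, 4 * k + 6})
    (by grind) (by grind)
    [[0, 1, 40 * k + 68], [0, 3, 16 * k + 25], [0, 5, 40 * k + 69], [0, 4 * k + 7, 44 * k + 73],
      [0, 6 * k + 9, 38 * k + 63], [0, 8 * k + 11, 44 * k + 72], [0, 8 * k + 13, 40 * k + 65],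
      [0, 16 * k + 23, 48 * k + 78], [0, 16 * k + 24, 32 * k + 53], [0, 16 * k + 26, 43 * k + 71],
      [0, 16 * k + 27, 37 * k + 62], [0, 16 * k + 28, 48 * k + 79]]
    (by simp) (by simp) ?_ ?_
  · simp only [List.map_cons, List.map_nil, List.sum_cons, List.sum_nil, List.length_cons,
      List.length_nil]
    grind
  · intro x hx htx hleft
    have hne : ∀ j ∈ [1, 2, 3, 4, 5, 6, 7, 8], x ≠ (6 * k + 10) * j := fun j _ hj => htx ⟨j, hj⟩
    simp only [Covers, IsSkipped, IsTripleDifference, InGap, Finset.mem_insert,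
      Finset.mem_singleton, List.mem_cons, List.not_mem_nil, or_false, exists_eq_or_imp,
      exists_eq_left, forall_eq_or_imp, forall_eq] at hne hleft ⊢
    grind

lemma exists_isCyclicDifferenceFamily_six_mul_add_twelve (k : ℕ) :
    ∃ F : Finset (Finset (ZMod (16 * (6 * k + 12)))),
      IsCyclicDifferenceFamily 16 (6 * k + 12) {3, 5} F := by
  refine exists_isCyclicDifferenceFamily_of_triples (by norm_num) (by omega)
    (c₀ := 24 * k + 48) (n₀ := 8 * k + 14) (E₀ := {0, 1, 3 * k + 6, 6 * k + 12})
    (c₁ := 40 * k + 79) (n₁ := 8 * k + 14)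
    (E₁ := {0, 1, 2, 2 * k + 4, 3 * k + 5, 4 * k + 7, 6 * k + 11})
    (by grind) (by grind)
    [[0, 1, 32 * k + 63], [0, 4 * k + 9, 44 * k + 87], [0, 6 * k + 11, 38 * k + 75],
      [0, 8 * k + 15, 48 * k + 95], [0, 12 * k + 23, 46 * k + 91], [0, 16 * k + 29, 48 * k + 94],
      [0, 16 * k + 31, 43 * k + 85], [0, 16 * k + 32, 37 * k + 74], [0, 16 * k + 34, 40 * k + 81],
      [0, 3, 5, 16 * k + 33, 40 * k + 82]]
    (by simp) (by simp) ?_ ?_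
  · simp only [List.map_cons, List.map_nil, List.sum_cons, List.sum_nil, List.length_cons,
      List.length_nil]
    grind
  · intro x hx htx hleft
    have hne : ∀ j ∈ [1, 2, 3, 4, 5, 6, 7, 8], x ≠ (6 * k + 12) * j := fun j _ hj => htx ⟨j, hj⟩
    simp only [Covers, IsSkipped, IsTripleDifference, InGap, Finset.mem_insert,
      Finset.mem_singleton, List.mem_cons, List.not_mem_nil, or_false, exists_eq_or_imp,
      exists_eq_left, forall_eq_or_imp, forall_eq] at hne hleft ⊢
    grind

lemma exists_isCyclicDifferenceFamily_six_mul_add_fourteen (k : ℕ) :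
    ∃ F : Finset (Finset (ZMod (16 * (6 * k + 14)))),
      IsCyclicDifferenceFamily 16 (6 * k + 14) {3, 5} F := by
  refine exists_isCyclicDifferenceFamily_of_triples (by norm_num) (by omega)
    (c₀ := 24 * k + 56) (n₀ := 8 * k + 15)
    (E₀ := {0, 1, 2, 3 * k + 6, 3 * k + 7, 3 * k + 8, 6 * k + 14})
    (c₁ := 40 * k + 93) (n₁ := 8 * k + 14)
    (E₁ := {0, 1, 2 * k + 4, 3 * k + 5, 3 * k + 6, 3 * k + 7, 4 * k + 9})
    (by grind) (by grind)
    [[0, 4, 16 * k + 33], [0, 4 * k + 9, 44 * k + 103], [0, 6 * k + 11, 43 * k + 99],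
      [0, 6 * k + 12, 38 * k + 89], [0, 6 * k + 15, 43 * k + 101], [0, 6 * k + 16, 27 * k + 64],
      [0, 8 * k + 19, 32 * k + 74], [0, 16 * k + 30, 48 * k + 109], [0, 16 * k + 31, 32 * k + 71],
      [0, 16 * k + 34, 40 * k + 92], [0, 16 * k + 36, 40 * k + 93], [0, 16 * k + 39, 48 * k + 111],
      [0, 16 * k + 41, 40 * k + 95], [0, 2, 32 * k + 75, 32 * k + 78, 48 * k + 110],
      [0, 6 * k + 13, 27 * k + 62, 27 * k + 63, 43 * k + 100]]
    (by simp) (by simp) ?_ ?_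
  · simp only [List.map_cons, List.map_nil, List.sum_cons, List.sum_nil, List.length_cons,
      List.length_nil]
    grind
  · intro x hx htx hleft
    have hne : ∀ j ∈ [1, 2, 3, 4, 5, 6, 7, 8], x ≠ (6 * k + 14) * j := fun j _ hj => htx ⟨j, hj⟩
    simp only [Covers, IsSkipped, IsTripleDifference, InGap, Finset.mem_insert,
      Finset.mem_singleton, List.mem_cons, List.not_mem_nil, or_false, exists_eq_or_imp,
      exists_eq_left, forall_eq_or_imp, forall_eq] at hne hleft ⊢
    grind

lemma exists_isCyclicDifferenceFamily_four :
    ∃ F : Finset (Finset (ZMod (16 * 4))), IsCyclicDifferenceFamily 16 4 {3} F :=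
  exists_isCyclicDifferenceFamily_of_covers (by norm_num) (by norm_num)
    [[0, 1, 26], [0, 2, 21], [0, 3, 13], [0, 5, 27], [0, 6, 15], [0, 7, 30], [0, 11, 29],
      [0, 14, 31]]
    (by simp) rfl (by decide)

lemma exists_isCyclicDifferenceFamily_six :
    ∃ F : Finset (Finset (ZMod (16 * 6))), IsCyclicDifferenceFamily 16 6 {3, 5} F :=
  exists_isCyclicDifferenceFamily_of_covers (by norm_num) (by norm_num)
    [[0, 1, 38], [0, 2, 45], [0, 5, 46], [0, 8, 39], [0, 9, 32], [0, 10, 44], [0, 11, 40],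
      [0, 13, 27], [0, 15, 35], [0, 16, 33], [0, 19, 22, 26, 47]]
    (by simp) rfl (by decide)

lemma exists_isCyclicDifferenceFamily_eight :
    ∃ F : Finset (Finset (ZMod (16 * 8))), IsCyclicDifferenceFamily 16 8 {3, 5} F :=
  exists_isCyclicDifferenceFamily_of_covers (by norm_num) (by norm_num)
    [[0, 3, 33], [0, 6, 53], [0, 7, 57], [0, 9, 45], [0, 10, 44], [0, 11, 60], [0, 12, 51],
      [0, 13, 54], [0, 14, 52], [0, 15, 61], [0, 21, 43], [0, 26, 55], [0, 1, 28, 59, 63],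
      [0, 5, 23, 25, 42]]
    (by simp) rfl (by decide)

end CDF

theorem lemma4p16 (t : ℕ) (ht : 4 ≤ t) (heven : Even t) :
    ∃ F : Finset (Finset (ZMod (16 * t))), IsCyclicDifferenceFamily 16 t {3, 5} F := by
  have hsub : ({3} : Set ℕ) ⊆ {3, 5} := by simp
  obtain ⟨m, rfl⟩ := heven.two_dvd
  obtain h | h | h | ⟨k, h | h | h⟩ : 2 * m = 4 ∨ 2 * m = 6 ∨ 2 * m = 8 ∨
      ∃ k, 2 * m = 6 * k + 10 ∨ 2 * m = 6 * k + 12 ∨ 2 * m = 6 * k + 14 := by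
    obtain hm | hm : m < 5 ∨ 5 ≤ m := lt_or_ge m 5
    · omega
    · exact .inr (.inr (.inr ⟨(m - 5) / 3, by omega⟩))
  all_goals rw [h]
  · exact CDF.exists_isCyclicDifferenceFamily_four.imp fun _ hF => hF.mono hsub
  · exact CDF.exists_isCyclicDifferenceFamily_six
  · exact CDF.exists_isCyclicDifferenceFamily_eight
  · exact (CDF.exists_isCyclicDifferenceFamily_six_mul_add_ten k).imp fun _ hF => hF.mono hsub
  · exact CDF.exists_isCyclicDifferenceFamily_six_mul_add_twelve k
  · exact CDF.exists_isCyclicDifferenceFamily_six_mul_add_fourteen k
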